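/- Let $\mathsf T$ be a finite simplicial triangulation of a connected surface, possibly with boundary, with vertex set $V$, edge set $E$ and set of triangles $T$. A \emph{discrete metric} is a function $\ell:E\to\mathbb R_{>0}$ that satisfies the strict triangle inequalities in every triangle; gluing hyperbolic triangles with side lengths $\ell$ gives the hyperbolic triangulation $(\mathsf T,\ell)_h$. Two discrete metrics $\ell,\tilde\ell$ (or $(\mathsf T,\ell)_h$, $(\mathsf T,\tilde\ell)_h$) are \emph{discretely conformally equivalent} if for some $u:V\to\mathbb R$ $$\sinh\tfrac{\tilde\ell_{ij}}2=e^{\frac12(u_i+u_j)}\sinh\tfrac{\ell_{ij}}2\qquad(ij\in E),\tag{1}$$ and the equivalence classes are called conformal classes. For $\Theta\in\mathbb R^V$ and $\lambda\in\mathbb R^E$ define $E^h_{\mathsf T,\Theta,\lambda}:\mathbb R^V\to\mathbb R$ by $$E^h_{\mathsf T,\Theta,\lambda}(u)=\sum_{ijk\in T}2\widehat V_h(\lambda_{ij},\lambda_{jk},\lambda_{ki},-u_i,-u_j,-u_k)+\sum_{i\in V}\Theta_iu_i,$$ $$\begin{aligned}2\widehat V_h(\lambda_{12},\lambda_{23},\lambda_{31},\lambda_1,\lambda_2,\lambda_3)={}&\alpha_1\lambda_1+\alpha_2\lambda_2+\alpha_3\lambda_3+\alpha_{12}\lambda_{12}+\alpha_{23}\lambda_{23}+\alpha_{31}\lambda_{31}\\&+\mathcal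 L(\alpha_1)+\mathcal L(\alpha_2)+\mathcal L(\alpha_3)+\mathcal L(\alpha_{12})+\mathcal L(\alpha_{23})+\mathcal L(\alpha_{31})+\mathcal L\big(\tfrac12(\pi-\alpha_1-\alpha_2-\alpha_3)\big),\end{aligned}$$ where $\mathcal L(x)=-\int_0^x\log|2\sin t|\,dt$; $\alpha_1,\alpha_2,\alpha_3$ are the angles (at the vertices $1,2,3$) of the hyperbolic triangle with side lengths $\tilde\ell_{ij}=2\operatorname{arsinh}\big(e^{\frac12(\lambda_{ij}-\lambda_i-\lambda_j)}\big)$ if these satisfy the strict triangle inequalities, and otherwise they are $\pi$ opposite the side that is too long and $0$ at the other two vertices; and $\alpha_{23}=\frac12(\pi+\alpha_1-\alpha_2-\alpha_3)$, $\alpha_{31}=\frac12(\pi-\alpha_1+\alpha_2-\alpha_3)$, $\alpha_{12}=\frac12(\pi-\alpha_1-\alpha_2+\alpha_3)$. Consider the following two problems. (A) Given a conformal class $\mathcal C$ of discrete metrics and $\Theta\in\mathbb R^V$, find $\tilde\ell\in\mathcal C$ such that $(\mathsf T,\tilde\ell)_h$ has angle sum $\Theta_i$ around every vertex $i$. (B)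 Given $\ell\in\mathbb R_{>0}^E$, a partition $V=V_0\,\dot\cup\,V_1$ (either part may be empty), a number $u_i$ for each $i\in V_0$ and $\Theta_i$ for each $i\in V_1$, find $u_i$ for the remaining vertices $i\in V_1$ such that $\tilde\ell$ determined by (1) is a discrete metric and $(\mathsf T,\tilde\ell)_h$ has angle sum $\Theta_i$ around every vertex $i\in V_1$. \textbf{Theorem.} For all $\Theta\in\mathbb R^V$ and $\lambda\in\mathbb R^E$ the function $E^h_{\mathsf T,\Theta,\lambda}$ is convex and continuously differentiable on $\mathbb R^V$. Moreover: (A) If problem (A) has a solution $\tilde\ell$, then it is the only one (there is no ambiguity of scale). For every $\ell\in\mathcal C$, with $\lambda=2\log\sinh\frac\ell2$, some $u\in\mathbb R^V$ satisfies (1) for this $\tilde\ell$ and is the unique minimizer of $E^h_{\mathsf T,\Theta,\lambda}$ on $\mathbb R^V$. (B) If problem (B) has a solution $u$, then it is the only one, and with $\lambda=2\log\sinh\frac\ell2$ it is the unique minimizer of $E^h_{\mathsf T,\Theta,\lambda}$ on the set of functions in $\mathbb R^V$ with the prescribed values on $V_0$ (for any choice of $\Theta_i$, $i\in V_0$). 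-/

import Mathlib

open Set

noncomputable section

/-! ### Triangulated surfaces -/

/-- A (simplicial) triangulation of a connected surface, possibly with boundary, with vertex set `V`
and set of triangles `F`; it is used with finite `V` and `F`.  The three corners of each triangle
are labelled by `Fin 3`, in an arbitrary order. -/
structure SurfaceTriangulation (V F : Type*) where
  /-- `vert f a` is the vertex at the corner `a` of the triangle `f`. -/
  vert : F → Fin 3 → V
  /-- The three vertices of a triangle are different. -/
  vert_injective : ∀ f, Function.Injective (vert f)
  /-- A triangle is determined by its vertices. -/
  face_ext : ∀ f g, range (vert f) = range (vert g) → f = g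
  /-- Every vertex belongs to a triangle. -/
  exists_vert : ∀ v, ∃ f a, vert f a = v
  /-- An edge belongs to at most two triangles. -/
  edge_le_two : ∀ i j, i ≠ j → {f | i ∈ range (vert f) ∧ j ∈ range (vert f)}.encard ≤ 2
  /-- The link of each vertex is connected; being a finite graph with all degrees `1` or `2`, it is
  then a path or a cycle. -/
  link_connected : ∀ v, (SimpleGraph.fromRel
    fun x y : {w : V // w ≠ v ∧ ∃ f, v ∈ range (vert f) ∧ w ∈ range (vert f)} =>
      ∃ f, v ∈ range (vert f) ∧ x.1 ∈ range (vert f) ∧ y.1 ∈ range (vert f)).Connected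
  /-- The surface is connected (and not empty). -/
  connected : (SimpleGraph.fromRel
    fun i j : V => ∃ f, i ∈ range (vert f) ∧ j ∈ range (vert f)).Connected

namespace SurfaceTriangulation

variable {V F : Type*} (T : SurfaceTriangulation V F)

/-- The edges: the unordered pairs of different vertices of a triangle. -/
def Edge : Type _ := {e : Sym2 V // ∃ f a, e = s(T.vert f (a + 1), T.vert f (a + 2))}

/-- The side of the triangle `f` that is opposite to the corner `a`. -/
def side (f : F) (a : Fin 3) : T.Edge := ⟨s(T.vert f (a + 1), T.vert f (a + 2)), f, a, rfl⟩

/-- The value `uᵢ + uⱼ` for the edge `ij`. -/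
def edgeSum (u : V → ℝ) (e : T.Edge) : ℝ :=
  Sym2.lift ⟨fun i j => u i + u j, fun i j => add_comm (u i) (u j)⟩ e.1

/-- A discrete metric: a positive function on the edges that satisfies all (strict) triangle
inequalities. -/
def IsDiscreteMetric (l : T.Edge → ℝ) : Prop :=
  (∀ e, 0 < l e) ∧ ∀ f a, l (T.side f a) < l (T.side f (a + 1)) + l (T.side f (a + 2))

end SurfaceTriangulation

/-! ### Hyperbolic triangles -/

/-- The angle opposite to the side of length `a` in a hyperbolic triangle with side lengths
`a`, `b`, `c`, by the hyperbolic cosine rule. -/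
def hypAngle (a b c : ℝ) : ℝ :=
  Real.arccos ((Real.cosh b * Real.cosh c - Real.cosh a) / (Real.sinh b * Real.sinh c))

/-- The scalar product of signature `(2, 1)` of the hyperboloid model, in which the hyperbolic plane
is `⟨x, x⟩ = -1`, `x₃ > 0` and the distance `d` of `x` and `y` satisfies `cosh d = -⟨x, y⟩`. -/
def mink (x y : Fin 3 → ℝ) : ℝ := x 0 * y 0 + x 1 * y 1 - x 2 * y 2

/-- In the hyperboloid model, `hypAngle` is the angle at `P` in the triangle `P Q R`: the angle
between the initial directions `Q - cosh c • P` and `R - cosh b • P` of the geodesics from `P` to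
`Q` and `R`. -/
theorem hypAngle_eq_arccos_mink {P Q R : Fin 3 → ℝ} {a b c : ℝ} (hP : mink P P = -1)
    (hQ : mink Q Q = -1) (hR : mink R R = -1) (hb : 0 < b) (hc : 0 < c)
    (hQR : Real.cosh a = -mink Q R) (hRP : Real.cosh b = -mink R P)
    (hPQ : Real.cosh c = -mink P Q) :
    hypAngle a b c = Real.arccos
      (mink (Q - Real.cosh c • P) (R - Real.cosh b • P) /
        (√(mink (R - Real.cosh b • P) (R - Real.cosh b • P)) *
          √(mink (Q - Real.cosh c • P) (Q - Real.cosh c • P)))) := by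
  have h1 : mink (R - Real.cosh b • P) (R - Real.cosh b • P) = Real.sinh b ^ 2 := by
    rw [Real.sinh_sq]
    simp only [mink, Pi.sub_apply, Pi.smul_apply, smul_eq_mul] at *
    linear_combination hR - 2 * Real.cosh b * hRP + Real.cosh b ^ 2 * hP
  have h2 : mink (Q - Real.cosh c • P) (Q - Real.cosh c • P) = Real.sinh c ^ 2 := by
    rw [Real.sinh_sq]
    simp only [mink, Pi.sub_apply, Pi.smul_apply, smul_eq_mul] at *
    linear_combination hQ - 2 * Real.cosh c * hPQ + Real.cosh c ^ 2 * hP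
  have h3 : mink (Q - Real.cosh c • P) (R - Real.cosh b • P)
      = Real.cosh b * Real.cosh c - Real.cosh a := by
    simp only [mink, Pi.sub_apply, Pi.smul_apply, smul_eq_mul] at *
    linear_combination hQR - Real.cosh c * hRP - Real.cosh b * hPQ
      + Real.cosh b * Real.cosh c * hP
  rw [h1, h2, h3, Real.sqrt_sq (Real.sinh_pos_iff.2 hb).le,
    Real.sqrt_sq (Real.sinh_pos_iff.2 hc).le, hypAngle]

/-- The angle opposite to the side of length `a`, extended to lengths that violate a triangle
inequality: in such a broken triangle the angles are `π` opposite to the side that is too long and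
`0` at the two other corners. -/
def extHypAngle (a b c : ℝ) : ℝ :=
  if b + c ≤ a then Real.pi
  else if c + a ≤ b ∨ a + b ≤ c then 0
  else hypAngle a b c

/-- Milnor's Lobachevsky function. -/
def lobachevsky (x : ℝ) : ℝ := -∫ t in (0 : ℝ)..x, Real.log |2 * Real.sin t|

/-- The length `ℓ̃ = 2 arsinh (exp (μ / 2))`, that is, the `ℓ̃` with `μ = 2 log (sinh (ℓ̃ / 2))`. -/
def lengthOfLog (μ : ℝ) : ℝ := 2 * Real.arsinh (Real.exp (μ / 2))

/-- The function `2 V̂ₕ(λ₁₂, λ₂₃, λ₃₁, λ₁, λ₂, λ₃)` for one triangle, extended to broken triangles. -/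
def twoVhat (l12 l23 l31 l1 l2 l3 : ℝ) : ℝ :=
  let d23 := lengthOfLog (l23 - l2 - l3)
  let d31 := lengthOfLog (l31 - l3 - l1)
  let d12 := lengthOfLog (l12 - l1 - l2)
  let α1 := extHypAngle d23 d31 d12
  let α2 := extHypAngle d31 d12 d23
  let α3 := extHypAngle d12 d23 d31
  let α23 := (Real.pi + α1 - α2 - α3) / 2
  let α31 := (Real.pi - α1 + α2 - α3) / 2
  let α12 := (Real.pi - α1 - α2 + α3) / 2
  α1 * l1 + α2 * l2 + α3 * l3 + α12 * l12 + α23 * l23 + α31 * l31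
    + lobachevsky α1 + lobachevsky α2 + lobachevsky α3
    + lobachevsky α12 + lobachevsky α23 + lobachevsky α31
    + lobachevsky ((Real.pi - α1 - α2 - α3) / 2)

namespace SurfaceTriangulation

variable {V F : Type*} (T : SurfaceTriangulation V F)

/-! ### Discrete conformal equivalence of hyperbolic triangulations -/

/-- Discrete conformal equivalence of the hyperbolic triangulations with edge lengths `l`, `l'`. -/
def ConfEquiv (l l' : T.Edge → ℝ) : Prop :=
  ∃ u : V → ℝ, ∀ e,
    Real.sinh (l' e / 2) = Real.exp (T.edgeSum u e / 2) * Real.sinh (l e / 2)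

/-- A discrete conformal class: all discrete metrics that are discretely conformally equivalent to
a given one. -/
def IsConfClass (C : Set (T.Edge → ℝ)) : Prop :=
  ∃ l, T.IsDiscreteMetric l ∧ C = {l' | T.IsDiscreteMetric l' ∧ T.ConfEquiv l l'}

/-- The lengths `ℓ̃` determined by `sinh (ℓ̃ᵢⱼ / 2) = exp ((uᵢ + uⱼ) / 2) sinh (ℓᵢⱼ / 2)`. -/
def confLength (l : T.Edge → ℝ) (u : V → ℝ) (e : T.Edge) : ℝ :=
  2 * Real.arsinh (Real.exp (T.edgeSum u e / 2) * Real.sinh (l e / 2))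

/-- The logarithmic lengths `λ = 2 log (sinh (ℓ / 2))`. -/
def logLength (l : T.Edge → ℝ) (e : T.Edge) : ℝ := 2 * Real.log (Real.sinh (l e / 2))

/-- The angle at the corner `a` of the triangle `f` of the hyperbolic triangulation with edge
lengths `l`. -/
def angle (l : T.Edge → ℝ) (f : F) (a : Fin 3) : ℝ :=
  hypAngle (l (T.side f a)) (l (T.side f (a + 1))) (l (T.side f (a + 2)))

open Classical in
/-- The sum of all angles around the vertex `i`. -/
def angleSum [Fintype F] (l : T.Edge → ℝ) (i : V) : ℝ :=
  ∑ f : F, ∑ a : Fin 3, if T.vert f a = i then T.angle l f a else 0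

/-- The function `Eʰ`, on the whole of `ℝⱽ`. -/
def energy [Fintype V] [Fintype F] (Θ : V → ℝ) (lam : T.Edge → ℝ) (u : V → ℝ) : ℝ :=
  ∑ f : F, twoVhat (lam (T.side f 2)) (lam (T.side f 0)) (lam (T.side f 1))
      (-u (T.vert f 0)) (-u (T.vert f 1)) (-u (T.vert f 2))
    + ∑ i : V, Θ i * u i

/-! ### The discrete conformal mapping problems -/

/-- `lt` solves the problem of finding a discrete metric in the conformal class `C` with angle sum
`Θ i` around each vertex `i`. -/
def SolvesAngleProblem [Fintype F] (C : Set (T.Edge → ℝ)) (Θ : V → ℝ) (lt : T.Edge → ℝ) : Prop :=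
  lt ∈ C ∧ ∀ i, T.angleSum lt i = Θ i

/-- `u` solves the mixed problem: the logarithmic scale factors are prescribed to be `u₀` on `V₀`,
the resulting lengths form a discrete metric, and the angle sums are prescribed to be `Θ` on the
complement of `V₀`. -/
def SolvesMixedProblem [Fintype F] (l : T.Edge → ℝ) (V₀ : Set V) (u₀ Θ u : V → ℝ) : Prop :=
  (∀ i ∈ V₀, u i = u₀ i) ∧ T.IsDiscreteMetric (T.confLength l u) ∧
    ∀ i, i ∉ V₀ → T.angleSum (T.confLength l u) i = Θ i

end SurfaceTriangulation

end

open Set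

noncomputable section

/-! ### The Lobachevsky function -/

/-! Put `p = l23 - l2 - l3`, `q = l31 - l3 - l1`, `r = l12 - l1 - l2`. For one triangle, `twoVhat`
is `π (l1 + l2 + l3)` plus the maximum of `angleEnergy p q r` over all triples of nonnegative
numbers with sum at most `π`, and the maximum is attained at the (extended) angles of the triangle.
For fixed angles this expression is affine in `l1, l2, l3`, so `twoVhat` is a maximum of affine
functions: it is convex and the maximizing angles are a subgradient (`twoVhat_subgradient`). The
angles depend continuously on the lengths, even across degenerate triangles, and a function with a
continuous subgradient is C¹. No second derivative of the energy is needed.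

The maximum property combines two facts. The volume term is strictly concave in the angles, because
the prism is cut into ideal tetrahedra (`prismVolume_lt`). The critical point equations are the
half-side formulas (`IsHypTriangle.log_sin_half_defect`). Broken triangles are reached by a limit
and a monotonicity argument (`lengthAngleEnergy_le_of_add_le`).

Uniqueness: at a proper triangle the subgradient inequality is strict (`twoVhat_subgradient_lt`).
Equality would give the other parameters the same angles, and a hyperbolic triangle is determined by
its angles. This is also why no scale freedom remains. Summed over the triangles, the linear term
has coefficients `Θ i` minus the angle sum at `i`. At a solution it vanishes on every admissible
variation, so the energy is strictly larger at every other admissible point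
(`SolvesMixedProblem.energy_lt`). Problem (A) is the mixed problem with `V₀ = ∅`. -/

theorem intervalIntegrable_log_abs_two_mul_sin (a b : ℝ) :
    IntervalIntegrable (fun t => Real.log |2 * Real.sin t|) MeasureTheory.volume a b := by
  have h : MeromorphicOn (fun t : ℝ => 2 * Real.sin t) (uIcc a b) := fun t _ => by
    have : AnalyticAt ℝ (fun t : ℝ => 2 * Real.sin t) t := by fun_prop
    exact this.meromorphicAt
  simpa [Real.norm_eq_abs] using h.intervalIntegrable_log_norm

theorem continuous_lobachevsky : Continuous lobachevsky :=
  (intervalIntegral.continuous_primitive intervalIntegrable_log_abs_two_mul_sin 0).neg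

theorem lobachevsky_pi : lobachevsky Real.pi = 0 := by
  have h : ∫ t in (0 : ℝ)..Real.pi, Real.log |2 * Real.sin t|
      = ∫ t in (0 : ℝ)..Real.pi, (Real.log 2 + Real.log (Real.sin t)) := by
    refine intervalIntegral.integral_congr_ae ?_
    have h0 : ∀ᵐ t : ℝ, t ≠ Real.pi := by simp [MeasureTheory.ae_iff]
    filter_upwards [h0] with t ht hmem
    rw [uIoc_of_le Real.pi_pos.le] at hmem
    have := Real.sin_pos_of_pos_of_lt_pi hmem.1 (lt_of_le_of_ne hmem.2 ht)
    rw [Real.log_abs, Real.log_mul two_ne_zero this.ne']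
  have h' := intervalIntegral.integral_add (a := 0) (b := Real.pi)
    (f := fun _ => Real.log 2) (g := fun t => Real.log (Real.sin t))
    (μ := MeasureTheory.volume) (by simp) intervalIntegrable_log_sin
  rw [lobachevsky, h, h', integral_log_sin_zero_pi]
  simp [mul_comm]

theorem lobachevsky_pi_sub (x : ℝ) : lobachevsky (Real.pi - x) = -lobachevsky x := by
  have h1 : ∫ t in (0 : ℝ)..Real.pi - x, Real.log |2 * Real.sin t|
      = ∫ t in x..Real.pi, Real.log |2 * Real.sin t| := by
    have := intervalIntegral.integral_comp_sub_left (a := 0) (b := Real.pi - x)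
      (fun t => Real.log |2 * Real.sin t|) Real.pi
    simpa using this
  have h2 := intervalIntegral.integral_add_adjacent_intervals
    (intervalIntegrable_log_abs_two_mul_sin 0 x) (intervalIntegrable_log_abs_two_mul_sin x Real.pi)
  have h3 := lobachevsky_pi
  simp only [lobachevsky] at h3 ⊢
  rw [h1]
  linarith

theorem hasDerivAt_lobachevsky {x : ℝ} (hx : 0 < Real.sin x) :
    HasDerivAt lobachevsky (-Real.log (2 * Real.sin x)) x := by
  have hc : ContinuousAt (fun t => Real.log |2 * Real.sin t|) x := by
    refine ContinuousAt.log (by fun_prop) ?_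
    positivity
  have h := intervalIntegral.integral_hasDerivAt_right
    (intervalIntegrable_log_abs_two_mul_sin 0 x)
    (Measurable.stronglyMeasurable (by fun_prop)).stronglyMeasurableAtFilter hc
  rw [Real.log_abs] at h
  exact h.neg

/-- The quadratic form of the Hessian of minus the volume of an ideal tetrahedron. -/
theorem cot_quadraticForm_pos {x y z p q r : ℝ} (hx : 0 < Real.sin x) (hy : 0 < Real.sin y)
    (hz : 0 < Real.sin z) (h : x + y + z = Real.pi) (hpqr : p + q + r = 0)
    (hne : ¬(p = 0 ∧ q = 0)) :
    0 < p ^ 2 * (Real.cos x / Real.sin x) + q ^ 2 * (Real.cos y / Real.sin y)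
      + r ^ 2 * (Real.cos z / Real.sin z) := by
  obtain rfl : z = Real.pi - (x + y) := by linarith
  obtain rfl : r = -(p + q) := by linarith
  rw [Real.sin_pi_sub] at hz
  rw [Real.sin_pi_sub, Real.cos_pi_sub]
  have hxx := Real.sin_sq_add_cos_sq x
  have hyy := Real.sin_sq_add_cos_sq y
  have hzz := Real.sin_sq_add_cos_sq (x + y)
  have key : p ^ 2 * (Real.cos x / Real.sin x) + q ^ 2 * (Real.cos y / Real.sin y)
      + (-(p + q)) ^ 2 * (-Real.cos (x + y) / Real.sin (x + y))
      = ((p * Real.sin y - Real.cos (x + y) * q * Real.sin x) ^ 2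
          + (q * Real.sin x * Real.sin (x + y)) ^ 2)
        / (Real.sin x * Real.sin y * Real.sin (x + y)) := by
    have e1 : Real.cos x * Real.sin (x + y) - Real.cos (x + y) * Real.sin x = Real.sin y := by
      rw [Real.sin_add, Real.cos_add]; linear_combination Real.sin y * hxx
    have e2 : Real.cos y * Real.sin (x + y) - Real.cos (x + y) * Real.sin y = Real.sin x := by
      rw [Real.sin_add, Real.cos_add]; linear_combination Real.sin x * hyy
    field_simp
    linear_combination p ^ 2 * Real.sin y * e1 + q ^ 2 * Real.sin x * e2
      - q ^ 2 * Real.sin x ^ 2 * hzz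
  rw [key]
  refine div_pos ?_ (by positivity)
  by_cases hq : q = 0
  · have hp : p ≠ 0 := fun hp => hne ⟨hp, hq⟩
    subst hq
    have : 0 < (p * Real.sin y) ^ 2 := by positivity
    simpa using this
  · have : 0 < (q * Real.sin x * Real.sin (x + y)) ^ 2 := by positivity
    positivity

/-- Strict concavity of the volume of an ideal tetrahedron as a function of its angles, as a
supergradient inequality at a point with positive angles. -/
theorem lobachevsky_triple_lt {x y z x' y' z' : ℝ} (hx : 0 < x) (hy : 0 < y) (hz : 0 < z)
    (h : x + y + z = Real.pi) (hx' : 0 ≤ x') (hy' : 0 ≤ y') (hz' : 0 ≤ z')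
    (h' : x' + y' + z' = Real.pi) (hne : ¬(x' = x ∧ y' = y)) :
    lobachevsky x' + lobachevsky y' + lobachevsky z' <
      lobachevsky x + lobachevsky y + lobachevsky z - Real.log (2 * Real.sin x) * (x' - x)
        - Real.log (2 * Real.sin y) * (y' - y) - Real.log (2 * Real.sin z) * (z' - z) := by
  have lin : ∀ v v' : ℝ, ∀ t, HasDerivAt (fun t : ℝ => v + t * (v' - v)) (v' - v) t := by
    intro v v' t
    simpa using ((hasDerivAt_id t).mul_const (v' - v)).const_add v
  have pos : ∀ {v v' t : ℝ}, 0 < v → 0 ≤ v' → 0 ≤ t → t < 1 → 0 < v + t * (v' - v) := by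
    intro v v' t hv hv' h0 h1
    nlinarith [mul_pos (sub_pos.2 h1) hv, mul_nonneg h0 hv']
  have sinpos : ∀ t : ℝ, 0 ≤ t → t < 1 → 0 < Real.sin (x + t * (x' - x)) ∧
      0 < Real.sin (y + t * (y' - y)) ∧ 0 < Real.sin (z + t * (z' - z)) := by
    intro t h0 h1
    have a1 := pos hx hx' h0 h1
    have a2 := pos hy hy' h0 h1
    have a3 := pos hz hz' h0 h1
    have s : (x + t * (x' - x)) + (y + t * (y' - y)) + (z + t * (z' - z)) = Real.pi := by
      linear_combination (1 - t) * h + t * h'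
    exact ⟨Real.sin_pos_of_pos_of_lt_pi a1 (by linarith),
      Real.sin_pos_of_pos_of_lt_pi a2 (by linarith), Real.sin_pos_of_pos_of_lt_pi a3 (by linarith)⟩
  let L' : ℝ → ℝ → ℝ → ℝ := fun v v' t => -Real.log (2 * Real.sin (v + t * (v' - v))) * (v' - v)
  let g : ℝ → ℝ := fun t => lobachevsky (x + t * (x' - x)) + lobachevsky (y + t * (y' - y))
    + lobachevsky (z + t * (z' - z))
  let g' : ℝ → ℝ := fun t => L' x x' t + L' y y' t + L' z z' t
  let c : ℝ → ℝ → ℝ → ℝ := fun v v' t =>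
    (v' - v) ^ 2 * (Real.cos (v + t * (v' - v)) / Real.sin (v + t * (v' - v)))
  have dL : ∀ v v' t : ℝ, 0 < Real.sin (v + t * (v' - v)) →
      HasDerivAt (fun t => lobachevsky (v + t * (v' - v))) (L' v v' t) t := fun v v' t hs =>
    HasDerivAt.comp (h₂ := lobachevsky) t (hasDerivAt_lobachevsky hs) (lin v v' t)
  have dL' : ∀ v v' t : ℝ, 0 < Real.sin (v + t * (v' - v)) →
      HasDerivAt (L' v v') (-c v v' t) t := fun v v' t hs => by
    have := ((((lin v v' t).sin.const_mul 2).log (by positivity)).neg.mul_const (v' - v))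
    refine this.congr_deriv ?_
    simp only [c]
    field_simp
  have dg : ∀ t : ℝ, 0 ≤ t → t < 1 → HasDerivAt g (g' t) t := fun t h0 h1 => by
    obtain ⟨s1, s2, s3⟩ := sinpos t h0 h1
    exact ((dL _ _ _ s1).add (dL _ _ _ s2)).add (dL _ _ _ s3)
  have dg' : ∀ t : ℝ, 0 ≤ t → t < 1 →
      HasDerivAt g' (-c x x' t + -c y y' t + -c z z' t) t := fun t h0 h1 => by
    obtain ⟨s1, s2, s3⟩ := sinpos t h0 h1
    exact ((dL' _ _ _ s1).add (dL' _ _ _ s2)).add (dL' _ _ _ s3)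
  have hcont : Continuous g := by
    have := continuous_lobachevsky
    fun_prop
  -- The mean value theorem is used for `g` and then for `g'` on `[0, ξ]`: the end point `t = 1` may
  -- have zero angles, where `g` is continuous but need not be differentiable.
  obtain ⟨ξ, hξ, e1⟩ := exists_hasDerivAt_eq_slope g g' zero_lt_one hcont.continuousOn
    fun t ht => dg t ht.1.le ht.2
  obtain ⟨η, hη, e2⟩ := exists_hasDerivAt_eq_slope g' _ hξ.1
    (fun t ht => (dg' t ht.1 (ht.2.trans_lt hξ.2)).continuousAt.continuousWithinAt)
    fun t ht => dg' t ht.1.le (ht.2.trans hξ.2)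
  have hη1 := hη.2.trans hξ.2
  obtain ⟨s1, s2, s3⟩ := sinpos η hη.1.le hη1
  have hQ : 0 < c x x' η + c y y' η + c z z' η :=
    cot_quadraticForm_pos s1 s2 s3 (by linear_combination (1 - η) * h + η * h')
      (by linear_combination h' - h) fun hpq => hne ⟨by linarith [hpq.1], by linarith [hpq.2]⟩
  have hlt : g' ξ < g' 0 := by
    have : (g' ξ - g' 0) / (ξ - 0) < 0 := by rw [← e2]; linarith
    have := (div_neg_iff.1 this).resolve_left fun h => by linarith [h.2, hξ.1]
    linarith [this.1]
  have hfin : g 1 < g 0 + g' 0 := by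
    rw [sub_zero, div_one] at e1
    linarith
  have g1 : g 1 = lobachevsky x' + lobachevsky y' + lobachevsky z' := by simp [g]
  have g0 : g 0 = lobachevsky x + lobachevsky y + lobachevsky z := by simp [g]
  have g0' : g' 0 = -Real.log (2 * Real.sin x) * (x' - x) + -Real.log (2 * Real.sin y) * (y' - y)
      + -Real.log (2 * Real.sin z) * (z' - z) := by simp [g', L']
  linarith

theorem lobachevsky_triple_le {x y z x' y' z' : ℝ} (hx : 0 < x) (hy : 0 < y) (hz : 0 < z)
    (h : x + y + z = Real.pi) (hx' : 0 ≤ x') (hy' : 0 ≤ y') (hz' : 0 ≤ z')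
    (h' : x' + y' + z' = Real.pi) :
    lobachevsky x' + lobachevsky y' + lobachevsky z' ≤
      lobachevsky x + lobachevsky y + lobachevsky z - Real.log (2 * Real.sin x) * (x' - x)
        - Real.log (2 * Real.sin y) * (y' - y) - Real.log (2 * Real.sin z) * (z' - z) := by
  by_cases hne : x' = x ∧ y' = y
  · obtain ⟨rfl, rfl⟩ := hne
    obtain rfl : z' = z := by linarith
    simp
  · exact (lobachevsky_triple_lt hx hy hz h hx' hy' hz' h' hne).le

/-! ### The volume of a prism with three right-angled sides -/

/-- The volume of the prism with angles `x`, `y`, `z`, as a sum of values of the Lobachevsky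
function. -/
def prismVolume (x y z : ℝ) : ℝ :=
  lobachevsky x + lobachevsky y + lobachevsky z
    + lobachevsky ((Real.pi + x - y - z) / 2) + lobachevsky ((Real.pi - x + y - z) / 2)
    + lobachevsky ((Real.pi - x - y + z) / 2) + lobachevsky ((Real.pi - x - y - z) / 2)

theorem continuous_prismVolume : Continuous fun v : ℝ × ℝ × ℝ => prismVolume v.1 v.2.1 v.2.2 := by
  have := continuous_lobachevsky
  unfold prismVolume
  fun_prop

/-- Strict concavity of the volume, proved by cutting the prism into three ideal tetrahedra. -/
theorem prismVolume_lt {α β γ x y z : ℝ} (hα : 0 < α) (hβ : 0 < β) (hγ : 0 < γ)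
    (hs : α + β + γ < Real.pi) (hx : 0 ≤ x) (hy : 0 ≤ y) (hz : 0 ≤ z) (hs' : x + y + z ≤ Real.pi)
    (hne : ¬(x = α ∧ y = β ∧ z = γ)) :
    prismVolume x y z < prismVolume α β γ
      - Real.log (2 * Real.sin α) * (x - α) - Real.log (2 * Real.sin β) * (y - β)
      - Real.log (2 * Real.sin γ) * (z - γ)
      - Real.log (2 * Real.sin ((Real.pi + α - β - γ) / 2)) * ((x - α) - (y - β) - (z - γ)) / 2
      - Real.log (2 * Real.sin ((Real.pi - α + β - γ) / 2)) * ((y - β) - (z - γ) - (x - α)) / 2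
      - Real.log (2 * Real.sin ((Real.pi - α - β + γ) / 2)) * ((z - γ) - (x - α) - (y - β)) / 2
      + Real.log (2 * Real.sin ((Real.pi - α - β - γ) / 2))
        * ((x - α) + (y - β) + (z - γ)) / 2 := by
  have p1 : 0 < (Real.pi + α - β - γ) / 2 := by linarith
  have p2 : 0 < (Real.pi - α + β - γ) / 2 := by linarith
  have p3 : 0 < (Real.pi - α - β + γ) / 2 := by linarith
  have p4 : 0 < (Real.pi - α - β - γ) / 2 := by linarith
  have p5 : 0 < Real.pi - (Real.pi - α + β - γ) / 2 := by linarith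
  have n1 : 0 ≤ (Real.pi + x - y - z) / 2 := by linarith
  have n2 : 0 ≤ (Real.pi - x + y - z) / 2 := by linarith
  have n3 : 0 ≤ (Real.pi - x - y + z) / 2 := by linarith
  have n4 : 0 ≤ (Real.pi - x - y - z) / 2 := by linarith
  have n5 : 0 ≤ Real.pi - (Real.pi - x + y - z) / 2 := by linarith
  -- The three tetrahedra. The angle `(π - α + β - γ) / 2` occurs twice, and its supplement once in
  -- the third tetrahedron; since `Λ(π - θ) = -Λ(θ)`, one copy cancels. Each of `α`, `β`, `γ`
  -- belongs to one tetrahedron, which supplies strictness when that angle changes.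
  have t1 := lobachevsky_triple_le hγ p2 p1 (by ring) hz n2 n1 (by ring)
  have t2 := lobachevsky_triple_le hα p3 p2 (by ring) hx n3 n2 (by ring)
  have t3 := lobachevsky_triple_le hβ p4 p5 (by ring) hy n4 n5 (by ring)
  have s1 := lobachevsky_triple_lt hγ p2 p1 (by ring) hz n2 n1 (by ring)
  have s2 := lobachevsky_triple_lt hα p3 p2 (by ring) hx n3 n2 (by ring)
  have s3 := lobachevsky_triple_lt hβ p4 p5 (by ring) hy n4 n5 (by ring)
  simp only [lobachevsky_pi_sub, Real.sin_pi_sub] at t3 s3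
  unfold prismVolume
  by_cases h1 : z = γ
  · by_cases h2 : x = α
    · have h3 : y ≠ β := fun h3 => hne ⟨h2, h3, h1⟩
      have := s3 fun h => h3 h.1
      linarith
    · have := s2 fun h => h2 h.1
      linarith
  · have := s1 fun h => h1 h.1
    linarith

/-- Only one of the two points has to be interior: the midpoint then is, and in the supergradient
inequalities based there the linear terms cancel. -/
theorem prismVolume_midpoint_lt {α β γ x y z : ℝ} (hα : 0 < α) (hβ : 0 < β) (hγ : 0 < γ)
    (hs : α + β + γ < Real.pi) (hx : 0 ≤ x) (hy : 0 ≤ y) (hz : 0 ≤ z) (hs' : x + y + z ≤ Real.pi)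
    (hne : ¬(x = α ∧ y = β ∧ z = γ)) :
    prismVolume x y z + prismVolume α β γ
      < 2 * prismVolume ((x + α) / 2) ((y + β) / 2) ((z + γ) / 2) := by
  have h1 := prismVolume_lt (α := (x + α) / 2) (β := (y + β) / 2) (γ := (z + γ) / 2)
    (by linarith) (by linarith) (by linarith) (by linarith) hx hy hz hs'
    fun h => hne ⟨by linarith [h.1], by linarith [h.2.1], by linarith [h.2.2]⟩
  have h2 := prismVolume_lt (α := (x + α) / 2) (β := (y + β) / 2) (γ := (z + γ) / 2)
    (by linarith) (by linarith) (by linarith) (by linarith) hα.le hβ.le hγ.le hs.le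
    fun h => hne ⟨by linarith [h.1], by linarith [h.2.1], by linarith [h.2.2]⟩
  linarith

/-- The function of the angles whose critical point is the triangle with logarithmic lengths `p`,
`q`, `r`. -/
def angleEnergy (p q r x y z : ℝ) : ℝ :=
  (Real.pi + x - y - z) / 2 * p + (Real.pi - x + y - z) / 2 * q + (Real.pi - x - y + z) / 2 * r
    + prismVolume x y z

theorem prismVolume_cyclic (x y z : ℝ) : prismVolume y z x = prismVolume x y z := by
  unfold prismVolume
  rw [show Real.pi + y - z - x = Real.pi - x + y - z by ring,
    show Real.pi - y + z - x = Real.pi - x - y + z by ring,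
    show Real.pi - y - z + x = Real.pi + x - y - z by ring,
    show Real.pi - y - z - x = Real.pi - x - y - z by ring]
  ring

theorem angleEnergy_cyclic (p q r x y z : ℝ) :
    angleEnergy q r p y z x = angleEnergy p q r x y z := by
  rw [angleEnergy, angleEnergy, prismVolume_cyclic]
  ring

/-- Under `hp`, `hq`, `hr` the gradient of `angleEnergy p q r` vanishes at `(α, β, γ)`, so the
supergradient inequality has no linear term left. -/
theorem angleEnergy_lt_of_log_sin {p q r α β γ x y z : ℝ} (hα : 0 < α) (hβ : 0 < β) (hγ : 0 < γ)
    (hs : α + β + γ < Real.pi) (hx : 0 ≤ x) (hy : 0 ≤ y) (hz : 0 ≤ z) (hs' : x + y + z ≤ Real.pi)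
    (hp : Real.log (2 * Real.sin ((Real.pi + α - β - γ) / 2)) = Real.log (2 * Real.sin β)
      + Real.log (2 * Real.sin γ) + p - Real.log (2 * Real.sin ((Real.pi - α - β - γ) / 2)))
    (hq : Real.log (2 * Real.sin ((Real.pi - α + β - γ) / 2)) = Real.log (2 * Real.sin γ)
      + Real.log (2 * Real.sin α) + q - Real.log (2 * Real.sin ((Real.pi - α - β - γ) / 2)))
    (hr : Real.log (2 * Real.sin ((Real.pi - α - β + γ) / 2)) = Real.log (2 * Real.sin α)
      + Real.log (2 * Real.sin β) + r - Real.log (2 * Real.sin ((Real.pi - α - β - γ) / 2)))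
    (hne : ¬(x = α ∧ y = β ∧ z = γ)) :
    angleEnergy p q r x y z < angleEnergy p q r α β γ := by
  have := prismVolume_lt hα hβ hγ hs hx hy hz hs' hne
  rw [hp, hq, hr] at this
  unfold angleEnergy
  linarith

/-! ### Angles of hyperbolic triangles -/

theorem hypAngle_comm (a b c : ℝ) : hypAngle a b c = hypAngle a c b := by
  rw [hypAngle, hypAngle, mul_comm (Real.cosh b), mul_comm (Real.sinh b)]

theorem hypAngle_nonneg (a b c : ℝ) : 0 ≤ hypAngle a b c := Real.arccos_nonneg _

theorem hypAngle_eq_pi {a b c : ℝ} (hb : 0 < b) (hc : 0 < c) (h : b + c ≤ a) :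
    hypAngle a b c = Real.pi := by
  have h1 := Real.sinh_pos_iff.2 hb
  have h2 := Real.sinh_pos_iff.2 hc
  have h3 : Real.cosh (b + c) ≤ Real.cosh a :=
    Real.cosh_le_cosh.2 (abs_le_abs_of_nonneg (by linarith) h)
  rw [Real.cosh_add] at h3
  refine Real.arccos_eq_pi.2 ?_
  rw [div_le_iff₀ (by positivity)]
  linarith

theorem hypAngle_eq_zero {a b c : ℝ} (ha : 0 < a) (hb : 0 < b) (hc : 0 < c) (h : c + a ≤ b) :
    hypAngle a b c = 0 := by
  have h1 := Real.sinh_pos_iff.2 hb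
  have h2 := Real.sinh_pos_iff.2 hc
  have h3 : Real.cosh a ≤ Real.cosh (b - c) :=
    Real.cosh_le_cosh.2 (abs_le_abs_of_nonneg ha.le (by linarith))
  rw [Real.cosh_sub] at h3
  refine Real.arccos_eq_zero.2 ?_
  rw [le_div_iff₀ (by positivity)]
  linarith

/-- `Real.arccos` is constant outside `[-1, 1]`, with values `π` and `0`, and the cosine rule leaves
this interval exactly in the right direction. Hence continuity of the extended angles needs no case
distinction. -/
theorem extHypAngle_eq_hypAngle {a b c : ℝ} (ha : 0 < a) (hb : 0 < b) (hc : 0 < c) :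
    extHypAngle a b c = hypAngle a b c := by
  unfold extHypAngle
  split_ifs with h1 h2
  · exact (hypAngle_eq_pi hb hc h1).symm
  · obtain h | h := h2
    · exact (hypAngle_eq_zero ha hb hc h).symm
    · rw [hypAngle_comm, hypAngle_eq_zero ha hc hb (by linarith)]
  · rfl

/-- The squared product of a sine of an angle and the hyperbolic sines of the adjacent sides. -/
def hypGram (a b c : ℝ) : ℝ :=
  2 * Real.cosh a * Real.cosh b * Real.cosh c - Real.cosh a ^ 2 - Real.cosh b ^ 2
    - Real.cosh c ^ 2 + 1

theorem hypGram_cyclic (a b c : ℝ) : hypGram b c a = hypGram a b c := by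
  unfold hypGram; ring

/-- The strict triangle inequalities for positive lengths. -/
structure IsHypTriangle (a b c : ℝ) : Prop where
  pos₁ : 0 < a
  pos₂ : 0 < b
  pos₃ : 0 < c
  lt₁ : a < b + c
  lt₂ : b < c + a
  lt₃ : c < a + b

namespace IsHypTriangle

variable {a b c : ℝ}

theorem cyclic (h : IsHypTriangle a b c) : IsHypTriangle b c a :=
  ⟨h.pos₂, h.pos₃, h.pos₁, h.lt₂, h.lt₃, h.lt₁⟩

theorem hypGram_eq (a b c : ℝ) : hypGram a b c = (Real.sinh b * Real.sinh c) ^ 2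
    - (Real.cosh b * Real.cosh c - Real.cosh a) ^ 2 := by
  rw [mul_pow, Real.sinh_sq, Real.sinh_sq, hypGram]
  ring

/-- The difference of squares factors as `(cosh (b + c) - cosh a) (cosh a - cosh (b - c))`. -/
theorem hypGram_pos (h : IsHypTriangle a b c) : 0 < hypGram a b c := by
  have h1 : Real.cosh a < Real.cosh (b + c) := Real.cosh_lt_cosh.2 (by
    rw [abs_of_pos h.pos₁, abs_of_pos (by linarith [h.pos₂, h.pos₃])]; exact h.lt₁)
  have h2 : Real.cosh (b - c) < Real.cosh a := Real.cosh_lt_cosh.2 (by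
    rw [abs_of_pos h.pos₁, abs_lt]; exact ⟨by linarith [h.lt₃], by linarith [h.lt₂]⟩)
  rw [Real.cosh_add] at h1
  rw [Real.cosh_sub] at h2
  rw [hypGram_eq]
  nlinarith [mul_pos (sub_pos.2 h1) (sub_pos.2 h2)]

theorem sinh_pos (h : IsHypTriangle a b c) :
    0 < Real.sinh a ∧ 0 < Real.sinh b ∧ 0 < Real.sinh c :=
  ⟨Real.sinh_pos_iff.2 h.pos₁, Real.sinh_pos_iff.2 h.pos₂, Real.sinh_pos_iff.2 h.pos₃⟩

theorem sq_ratio (h : IsHypTriangle a b c) :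
    1 - ((Real.cosh b * Real.cosh c - Real.cosh a) / (Real.sinh b * Real.sinh c)) ^ 2
      = hypGram a b c / (Real.sinh b * Real.sinh c) ^ 2 := by
  obtain ⟨-, h2, h3⟩ := h.sinh_pos
  rw [hypGram_eq]
  field_simp

theorem cos_hypAngle (h : IsHypTriangle a b c) : Real.cos (hypAngle a b c)
    = (Real.cosh b * Real.cosh c - Real.cosh a) / (Real.sinh b * Real.sinh c) := by
  obtain ⟨-, h2, h3⟩ := h.sinh_pos
  have : 0 < 1 - ((Real.cosh b * Real.cosh c - Real.cosh a) / (Real.sinh b * Real.sinh c)) ^ 2 := by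
    rw [h.sq_ratio]
    have := h.hypGram_pos
    positivity
  have := abs_le.1 (sq_le_one_iff_abs_le_one _ |>.1 (sub_pos.1 this).le)
  exact Real.cos_arccos this.1 this.2

theorem sin_hypAngle (h : IsHypTriangle a b c) :
    Real.sin (hypAngle a b c) = √(hypGram a b c) / (Real.sinh b * Real.sinh c) := by
  obtain ⟨-, h2, h3⟩ := h.sinh_pos
  rw [hypAngle, Real.sin_arccos, h.sq_ratio, Real.sqrt_div h.hypGram_pos.le,
    Real.sqrt_sq (by positivity)]

theorem sin_hypAngle_pos (h : IsHypTriangle a b c) : 0 < Real.sin (hypAngle a b c) := by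
  obtain ⟨-, h2, h3⟩ := h.sinh_pos
  have := Real.sqrt_pos.2 h.hypGram_pos
  rw [h.sin_hypAngle]
  positivity

theorem hypAngle_pos (h : IsHypTriangle a b c) : 0 < hypAngle a b c :=
  (hypAngle_nonneg a b c).lt_of_ne fun h0 => by simpa [← h0] using h.sin_hypAngle_pos

theorem hypAngle_lt_pi (h : IsHypTriangle a b c) : hypAngle a b c < Real.pi :=
  (Real.arccos_le_pi _).lt_of_ne fun h0 => by
    have := h.sin_hypAngle_pos
    rw [hypAngle, h0, Real.sin_pi] at this
    exact this.false

/-- The dual cosine rule. -/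
theorem cos_add_cos_add (h : IsHypTriangle a b c) :
    Real.cos (hypAngle a b c) + Real.cos (hypAngle b c a + hypAngle c a b)
      = Real.sin (hypAngle b c a) * Real.sin (hypAngle c a b) * (Real.cosh a - 1) := by
  obtain ⟨h1, h2, h3⟩ := h.sinh_pos
  rw [Real.cos_add, h.cos_hypAngle, h.cyclic.cos_hypAngle, h.cyclic.cyclic.cos_hypAngle,
    h.cyclic.sin_hypAngle, h.cyclic.cyclic.sin_hypAngle, hypGram_cyclic b c a,
    hypGram_cyclic a b c]
  have e := Real.sq_sqrt h.hypGram_pos.le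
  have e1 := Real.sinh_sq a
  have : √(hypGram a b c) / (Real.sinh c * Real.sinh a) * (√(hypGram a b c)
      / (Real.sinh a * Real.sinh b)) = hypGram a b c
      / (Real.sinh a ^ 2 * Real.sinh b * Real.sinh c) := by
    rw [div_mul_div_comm, ← sq, e]; congr 1; ring
  rw [this]
  field_simp
  rw [e1]
  unfold hypGram
  ring

/-- The sine of the sum is an explicit positive expression, while the sum is below `2π`, and on `[π,
2π]` the sine is not positive. -/
theorem add_hypAngle_lt_pi (h : IsHypTriangle a b c) :
    hypAngle b c a + hypAngle c a b < Real.pi := by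
  obtain ⟨h1, h2, h3⟩ := h.sinh_pos
  by_contra! hle
  have hs : 0 < Real.sin (hypAngle b c a + hypAngle c a b) := by
    rw [Real.sin_add, h.cyclic.cos_hypAngle, h.cyclic.cyclic.cos_hypAngle,
      h.cyclic.sin_hypAngle, h.cyclic.cyclic.sin_hypAngle, hypGram_cyclic b c a,
      hypGram_cyclic a b c]
    have e := Real.sqrt_pos.2 h.hypGram_pos
    have e1 := Real.one_lt_cosh.2 h.pos₁.ne'
    have e2 := Real.cosh_pos b
    have e3 := Real.cosh_pos c
    have : √(hypGram a b c) / (Real.sinh c * Real.sinh a)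
          * ((Real.cosh a * Real.cosh b - Real.cosh c) / (Real.sinh a * Real.sinh b))
        + (Real.cosh c * Real.cosh a - Real.cosh b) / (Real.sinh c * Real.sinh a)
          * (√(hypGram a b c) / (Real.sinh a * Real.sinh b))
        = √(hypGram a b c) * (Real.cosh b + Real.cosh c) * (Real.cosh a - 1)
          / (Real.sinh a ^ 2 * Real.sinh b * Real.sinh c) := by
      field_simp
      ring
    rw [this]
    have := sub_pos.2 e1
    positivity
  have := Real.sin_nonpos_of_nonpos_of_neg_pi_le
    (x := hypAngle b c a + hypAngle c a b - 2 * Real.pi)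
    (by linarith [h.cyclic.hypAngle_lt_pi, h.cyclic.cyclic.hypAngle_lt_pi]) (by linarith)
  rw [Real.sin_sub_two_pi] at this
  linarith

/-- The dual cosine rule gives `cos (β + γ) > cos (π - α)`. The cosine decreases on `[0, π]`, which
contains `β + γ` by `add_hypAngle_lt_pi`. -/
theorem sum_hypAngle_lt_pi (h : IsHypTriangle a b c) :
    hypAngle a b c + hypAngle b c a + hypAngle c a b < Real.pi := by
  have h1 := h.cos_add_cos_add
  have h2 := h.cyclic.sin_hypAngle_pos
  have h3 := h.cyclic.cyclic.sin_hypAngle_pos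
  have h4 := sub_pos.2 (Real.one_lt_cosh.2 h.pos₁.ne')
  have h5 : Real.cos (Real.pi - hypAngle a b c) < Real.cos (hypAngle b c a + hypAngle c a b) := by
    rw [Real.cos_pi_sub]
    have := mul_pos (mul_pos h2 h3) h4
    linarith
  have h6 := (Real.strictAntiOn_cos.lt_iff_gt
    ⟨by linarith [h.hypAngle_lt_pi], by linarith [h.hypAngle_pos]⟩
    ⟨by linarith [hypAngle_nonneg b c a, hypAngle_nonneg c a b], h.add_hypAngle_lt_pi.le⟩).1 h5
  linarith

/-- The half-side formula. -/
theorem log_sin_half_defect (h : IsHypTriangle a b c) :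
    Real.log (2 * Real.sin ((Real.pi + hypAngle a b c - hypAngle b c a - hypAngle c a b) / 2))
      = Real.log (2 * Real.sin (hypAngle b c a)) + Real.log (2 * Real.sin (hypAngle c a b))
        + 2 * Real.log (Real.sinh (a / 2)) - Real.log (2 * Real.sin
          ((Real.pi - hypAngle a b c - hypAngle b c a - hypAngle c a b) / 2)) := by
  have h1 := h.cos_add_cos_add
  have h2 := h.cyclic.sin_hypAngle_pos
  have h3 := h.cyclic.cyclic.sin_hypAngle_pos
  have h4 := h.sum_hypAngle_lt_pi
  have a1 := h.hypAngle_pos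
  have a2 := h.cyclic.hypAngle_pos
  have a3 := h.cyclic.cyclic.hypAngle_pos
  generalize hypAngle a b c = α at *
  generalize hypAngle b c a = β at *
  generalize hypAngle c a b = γ at *
  have s1 : 0 < Real.sin ((Real.pi + α - β - γ) / 2) :=
    Real.sin_pos_of_pos_of_lt_pi (by linarith) (by linarith)
  have s2 : 0 < Real.sin ((Real.pi - α - β - γ) / 2) :=
    Real.sin_pos_of_pos_of_lt_pi (by linarith) (by linarith)
  have s3 : 0 < Real.sinh (a / 2) := Real.sinh_pos_iff.2 (by linarith [h.pos₁])
  -- This is the dual cosine rule with `cosh a - 1 = 2 sinh² (a / 2)`, its left side turned into a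
  -- product of sines.
  have e : (2 * Real.sin ((Real.pi + α - β - γ) / 2)) * (2 * Real.sin ((Real.pi - α - β - γ) / 2))
      = (2 * Real.sin β) * (2 * Real.sin γ) * Real.sinh (a / 2) ^ 2 := by
    have c1 := Real.cos_sub ((Real.pi + α - β - γ) / 2) ((Real.pi - α - β - γ) / 2)
    have c2 := Real.cos_add ((Real.pi + α - β - γ) / 2) ((Real.pi - α - β - γ) / 2)
    rw [show (Real.pi + α - β - γ) / 2 - (Real.pi - α - β - γ) / 2 = α by ring] at c1
    rw [show (Real.pi + α - β - γ) / 2 + (Real.pi - α - β - γ) / 2 = Real.pi - (β + γ) by ring,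
      Real.cos_pi_sub] at c2
    have c3 : Real.cosh a - 1 = 2 * Real.sinh (a / 2) ^ 2 := by
      have := Real.cosh_two_mul (a / 2)
      rw [mul_div_cancel₀ _ two_ne_zero, Real.cosh_sq] at this
      linarith
    rw [c3] at h1
    linear_combination 2 * h1 - 2 * c1 + 2 * c2
  have key : ∀ A B C D S : ℝ, 0 < A → 0 < B → 0 < C → 0 < D → 0 < S → A * B = C * D * S ^ 2 →
      Real.log A = Real.log C + Real.log D + 2 * Real.log S - Real.log B := by
    intro A B C D S hA hB hC hD hS hE
    have := congrArg Real.log hE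
    rw [Real.log_mul hA.ne' hB.ne', Real.log_mul (by positivity) (by positivity),
      Real.log_mul hC.ne' hD.ne', Real.log_pow] at this
    push_cast at this
    linarith
  exact key _ _ _ _ _ (by positivity) (by positivity) (by positivity) (by positivity) s3 e

end IsHypTriangle

/-! ### The angles maximize the angle energy -/

/-- The angle energy with the logarithmic lengths of a triangle with sides `a`, `b`, `c`. -/
def lengthAngleEnergy (a b c x y z : ℝ) : ℝ :=
  angleEnergy (2 * Real.log (Real.sinh (a / 2))) (2 * Real.log (Real.sinh (b / 2)))
    (2 * Real.log (Real.sinh (c / 2))) x y z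

theorem lengthAngleEnergy_cyclic (a b c x y z : ℝ) :
    lengthAngleEnergy b c a y z x = lengthAngleEnergy a b c x y z :=
  angleEnergy_cyclic ..

/-- The half-side formulas for the three sides are the critical point equations. -/
theorem IsHypTriangle.lengthAngleEnergy_lt {a b c x y z : ℝ} (h : IsHypTriangle a b c)
    (hx : 0 ≤ x) (hy : 0 ≤ y) (hz : 0 ≤ z) (hs : x + y + z ≤ Real.pi)
    (hne : ¬(x = hypAngle a b c ∧ y = hypAngle b c a ∧ z = hypAngle c a b)) :
    lengthAngleEnergy a b c x y z
      < lengthAngleEnergy a b c (hypAngle a b c) (hypAngle b c a) (hypAngle c a b) := by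
  have h2 := h.cyclic.log_sin_half_defect
  have h3 := h.cyclic.cyclic.log_sin_half_defect
  refine angleEnergy_lt_of_log_sin h.hypAngle_pos h.cyclic.hypAngle_pos
    h.cyclic.cyclic.hypAngle_pos h.sum_hypAngle_lt_pi hx hy hz hs h.log_sin_half_defect ?_ ?_ hne
  · convert h2 using 5 <;> ring
  · convert h3 using 5 <;> ring

theorem ContinuousAt.hypAngle {X : Type*} [TopologicalSpace X] {f g h : X → ℝ} {x : X}
    (hf : ContinuousAt f x) (hg : ContinuousAt g x) (hh : ContinuousAt h x) (hb : 0 < g x)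
    (hc : 0 < h x) : ContinuousAt (fun x => hypAngle (f x) (g x) (h x)) x := by
  have h1 := Real.sinh_pos_iff.2 hb
  have h2 := Real.sinh_pos_iff.2 hc
  have cosh : ∀ {k : X → ℝ}, ContinuousAt k x → ContinuousAt (fun y => Real.cosh (k y)) x :=
    fun hk => Real.continuous_cosh.continuousAt.comp hk
  have sinh : ∀ {k : X → ℝ}, ContinuousAt k x → ContinuousAt (fun y => Real.sinh (k y)) x :=
    fun hk => Real.continuous_sinh.continuousAt.comp hk
  exact Real.continuous_arccos.continuousAt.comp ((((cosh hg).mul (cosh hh)).sub (cosh hf)).div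
    ((sinh hg).mul (sinh hh)) (mul_pos h1 h2).ne')

theorem hypAngle_of_add_le {a b c : ℝ} (ha : 0 < a) (hb : 0 < b) (hc : 0 < c) (h : b + c ≤ a) :
    hypAngle a b c = Real.pi ∧ hypAngle b c a = 0 ∧ hypAngle c a b = 0 := by
  refine ⟨hypAngle_eq_pi hb hc h, ?_, hypAngle_eq_zero hc ha hb h⟩
  rw [hypAngle_comm, hypAngle_eq_zero hb ha hc (by linarith)]

/-- At `a = b + c` this is a limit of proper triangles. Lengthening `a` further favours `(π, 0, 0)`,
where the coefficient `(π + x - y - z) / 2` of the logarithmic length is largest. -/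
theorem lengthAngleEnergy_le_of_add_le {a b c x y z : ℝ} (hb : 0 < b) (hc : 0 < c)
    (h : b + c ≤ a) (hx : 0 ≤ x) (hy : 0 ≤ y) (hz : 0 ≤ z) (hs : x + y + z ≤ Real.pi) :
    lengthAngleEnergy a b c x y z ≤ lengthAngleEnergy a b c Real.pi 0 0 := by
  have hbc : |b - c| < b + c := abs_lt.2 ⟨by linarith, by linarith⟩
  have h1 : lengthAngleEnergy (b + c) b c x y z ≤ lengthAngleEnergy (b + c) b c
      (hypAngle (b + c) b c) (hypAngle b c (b + c)) (hypAngle c (b + c) b) := by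
    refine ContinuousWithinAt.closure_le (s := Ioo |b - c| (b + c))
      (f := fun s => lengthAngleEnergy s b c x y z)
      (g := fun s => lengthAngleEnergy s b c (hypAngle s b c) (hypAngle b c s) (hypAngle c s b))
      ?_ (ContinuousAt.continuousWithinAt ?_) (ContinuousAt.continuousWithinAt ?_) ?_
    · rw [closure_Ioo hbc.ne]
      exact ⟨hbc.le, le_rfl⟩
    · have : ContinuousAt (fun s => Real.log (Real.sinh (s / 2))) (b + c) :=
        ContinuousAt.log (by fun_prop) (Real.sinh_pos_iff.2 (by positivity)).ne'
      unfold lengthAngleEnergy angleEnergy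
      fun_prop
    · have h0 : ContinuousAt (fun s => Real.log (Real.sinh (s / 2))) (b + c) :=
        ContinuousAt.log (by fun_prop) (Real.sinh_pos_iff.2 (by positivity)).ne'
      have c1 : ContinuousAt (fun s => hypAngle s b c) (b + c) :=
        continuousAt_id.hypAngle continuousAt_const continuousAt_const hb hc
      have c2 : ContinuousAt (fun s => hypAngle b c s) (b + c) :=
        continuousAt_const.hypAngle continuousAt_const continuousAt_id hc (add_pos hb hc)
      have c3 : ContinuousAt (fun s => hypAngle c s b) (b + c) :=
        continuousAt_const.hypAngle continuousAt_id continuousAt_const (add_pos hb hc) hb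
      have c4 := continuous_prismVolume.continuousAt.comp (c1.prodMk (c2.prodMk c3))
      simp only [Function.comp_def] at c4
      unfold lengthAngleEnergy angleEnergy
      fun_prop
    · rintro s ⟨hs1, hs2⟩
      have := abs_lt.1 hs1
      have ht : IsHypTriangle s b c :=
        ⟨(abs_nonneg _).trans_lt hs1, hb, hc, hs2, by linarith, by linarith⟩
      by_cases hne : x = hypAngle s b c ∧ y = hypAngle b c s ∧ z = hypAngle c s b
      · rw [← hne.1, ← hne.2.1, ← hne.2.2]
      · exact (ht.lengthAngleEnergy_lt hx hy hz hs hne).le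
  obtain ⟨e1, e2, e3⟩ := hypAngle_of_add_le (add_pos hb hc) hb hc le_rfl
  rw [e1, e2, e3] at h1
  have h2 : Real.log (Real.sinh ((b + c) / 2)) ≤ Real.log (Real.sinh (a / 2)) :=
    Real.log_le_log (Real.sinh_pos_iff.2 (by positivity)) (Real.sinh_le_sinh.2 (by linarith))
  unfold lengthAngleEnergy angleEnergy at *
  nlinarith [mul_nonneg (by linarith : 0 ≤ Real.pi - x + y + z) (sub_nonneg.2 h2)]

/-- Trichotomy for positive lengths: a proper triangle, or one side is too long. -/
theorem isHypTriangle_or {a b c : ℝ} (ha : 0 < a) (hb : 0 < b) (hc : 0 < c) :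
    IsHypTriangle a b c ∨ b + c ≤ a ∨ c + a ≤ b ∨ a + b ≤ c := by
  by_contra! h
  exact h.1 ⟨ha, hb, hc, h.2.1, h.2.2.1, h.2.2.2⟩

theorem sum_hypAngle_le_pi {a b c : ℝ} (ha : 0 < a) (hb : 0 < b) (hc : 0 < c) :
    hypAngle a b c + hypAngle b c a + hypAngle c a b ≤ Real.pi := by
  obtain h | h | h | h := isHypTriangle_or ha hb hc
  · exact h.sum_hypAngle_lt_pi.le
  · obtain ⟨h1, h2, h3⟩ := hypAngle_of_add_le ha hb hc h
    linarith
  · obtain ⟨h1, h2, h3⟩ := hypAngle_of_add_le hb hc ha h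
    linarith
  · obtain ⟨h1, h2, h3⟩ := hypAngle_of_add_le hc ha hb h
    linarith

theorem lengthAngleEnergy_le {a b c x y z : ℝ} (ha : 0 < a) (hb : 0 < b) (hc : 0 < c)
    (hx : 0 ≤ x) (hy : 0 ≤ y) (hz : 0 ≤ z) (hs : x + y + z ≤ Real.pi) :
    lengthAngleEnergy a b c x y z
      ≤ lengthAngleEnergy a b c (hypAngle a b c) (hypAngle b c a) (hypAngle c a b) := by
  obtain h | h | h | h := isHypTriangle_or ha hb hc
  · by_cases hne : x = hypAngle a b c ∧ y = hypAngle b c a ∧ z = hypAngle c a b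
    · rw [← hne.1, ← hne.2.1, ← hne.2.2]
    · exact (h.lengthAngleEnergy_lt hx hy hz hs hne).le
  · obtain ⟨h1, h2, h3⟩ := hypAngle_of_add_le ha hb hc h
    rw [h1, h2, h3]
    exact lengthAngleEnergy_le_of_add_le hb hc h hx hy hz hs
  · obtain ⟨h1, h2, h3⟩ := hypAngle_of_add_le hb hc ha h
    rw [h1, h2, h3, ← lengthAngleEnergy_cyclic, ← lengthAngleEnergy_cyclic a]
    exact lengthAngleEnergy_le_of_add_le hc ha h hy hz hx (by linarith)
  · obtain ⟨h1, h2, h3⟩ := hypAngle_of_add_le hc ha hb h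
    rw [h1, h2, h3, lengthAngleEnergy_cyclic c a b, lengthAngleEnergy_cyclic c a b]
    exact lengthAngleEnergy_le_of_add_le ha hb h hz hx hy (by linarith)

/-- Valid for broken triangles too: if an interior point reached the maximum, its midpoint with the
maximizing angles would exceed it. -/
theorem lengthAngleEnergy_lt {a b c x y z : ℝ} (ha : 0 < a) (hb : 0 < b) (hc : 0 < c)
    (hx : 0 < x) (hy : 0 < y) (hz : 0 < z) (hs : x + y + z < Real.pi)
    (hne : ¬(x = hypAngle a b c ∧ y = hypAngle b c a ∧ z = hypAngle c a b)) :
    lengthAngleEnergy a b c x y z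
      < lengthAngleEnergy a b c (hypAngle a b c) (hypAngle b c a) (hypAngle c a b) := by
  have h1 := hypAngle_nonneg a b c
  have h2 := hypAngle_nonneg b c a
  have h3 := hypAngle_nonneg c a b
  have h4 := sum_hypAngle_le_pi ha hb hc
  have hmid := prismVolume_midpoint_lt hx hy hz hs h1 h2 h3 h4
    fun h => hne ⟨h.1.symm, h.2.1.symm, h.2.2.symm⟩
  have hle := lengthAngleEnergy_le ha hb hc (x := (hypAngle a b c + x) / 2)
    (y := (hypAngle b c a + y) / 2) (z := (hypAngle c a b + z) / 2) (by positivity)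
    (by positivity) (by positivity) (by linarith)
  unfold lengthAngleEnergy angleEnergy at *
  linarith

/-- A hyperbolic triangle is determined by its angles. -/
theorem IsHypTriangle.length_eq {a b c a' b' c' : ℝ} (h : IsHypTriangle a b c)
    (h' : IsHypTriangle a' b' c') (e1 : hypAngle a b c = hypAngle a' b' c')
    (e2 : hypAngle b c a = hypAngle b' c' a') (e3 : hypAngle c a b = hypAngle c' a' b') :
    a = a' := by
  -- The dual cosine rule determines `cosh a` from the angles, as the sines are positive.
  have h1 := h.cos_add_cos_add
  have h2 := h'.cos_add_cos_add
  rw [e1, e2, e3, h2] at h1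
  have s1 := h'.cyclic.sin_hypAngle_pos
  have s2 := h'.cyclic.cyclic.sin_hypAngle_pos
  have := mul_left_cancel₀ (mul_pos s1 s2).ne' h1
  have : Real.cosh a' = Real.cosh a := by linarith
  have := Real.cosh_le_cosh.1 this.le
  have := Real.cosh_le_cosh.1 ‹Real.cosh a' = Real.cosh a›.ge
  rw [abs_of_pos h.pos₁, abs_of_pos h'.pos₁] at *
  linarith

/-! ### The extended volume function of one triangle -/

theorem lengthOfLog_pos (μ : ℝ) : 0 < lengthOfLog μ :=
  mul_pos two_pos (Real.arsinh_pos_iff.2 (Real.exp_pos _))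

theorem two_mul_log_sinh_lengthOfLog (μ : ℝ) :
    2 * Real.log (Real.sinh (lengthOfLog μ / 2)) = μ := by
  rw [lengthOfLog, mul_div_cancel_left₀ _ two_ne_zero, Real.sinh_arsinh, Real.log_exp]
  ring

theorem lengthOfLog_injective : Function.Injective lengthOfLog := fun μ ν h => by
  rw [← two_mul_log_sinh_lengthOfLog μ, h, two_mul_log_sinh_lengthOfLog]

theorem continuous_lengthOfLog : Continuous lengthOfLog := by
  unfold lengthOfLog
  exact continuous_const.mul (Real.continuous_arsinh.comp (by fun_prop))

theorem lengthAngleEnergy_lengthOfLog (p q r x y z : ℝ) :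
    lengthAngleEnergy (lengthOfLog p) (lengthOfLog q) (lengthOfLog r) x y z
      = angleEnergy p q r x y z := by
  simp only [lengthAngleEnergy, two_mul_log_sinh_lengthOfLog]

/-- Rests on `α12 + α31 = π - α1` and its cyclic analogues. -/
theorem twoVhat_eq (l12 l23 l31 l1 l2 l3 : ℝ) :
    twoVhat l12 l23 l31 l1 l2 l3 = Real.pi * (l1 + l2 + l3)
      + lengthAngleEnergy (lengthOfLog (l23 - l2 - l3)) (lengthOfLog (l31 - l3 - l1))
          (lengthOfLog (l12 - l1 - l2))
          (hypAngle (lengthOfLog (l23 - l2 - l3)) (lengthOfLog (l31 - l3 - l1))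
            (lengthOfLog (l12 - l1 - l2)))
          (hypAngle (lengthOfLog (l31 - l3 - l1)) (lengthOfLog (l12 - l1 - l2))
            (lengthOfLog (l23 - l2 - l3)))
          (hypAngle (lengthOfLog (l12 - l1 - l2)) (lengthOfLog (l23 - l2 - l3))
            (lengthOfLog (l31 - l3 - l1))) := by
  simp only [twoVhat, extHypAngle_eq_hypAngle, lengthOfLog_pos, lengthAngleEnergy_lengthOfLog,
    angleEnergy, prismVolume]
  ring

/-- The angles form a subgradient of the extended volume function. -/
theorem twoVhat_subgradient (l12 l23 l31 l1 l2 l3 m1 m2 m3 : ℝ) :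
    twoVhat l12 l23 l31 l1 l2 l3
      + hypAngle (lengthOfLog (l23 - l2 - l3)) (lengthOfLog (l31 - l3 - l1))
          (lengthOfLog (l12 - l1 - l2)) * (m1 - l1)
      + hypAngle (lengthOfLog (l31 - l3 - l1)) (lengthOfLog (l12 - l1 - l2))
          (lengthOfLog (l23 - l2 - l3)) * (m2 - l2)
      + hypAngle (lengthOfLog (l12 - l1 - l2)) (lengthOfLog (l23 - l2 - l3))
          (lengthOfLog (l31 - l3 - l1)) * (m3 - l3)
      ≤ twoVhat l12 l23 l31 m1 m2 m3 := by
  -- The angles for `l` compete in the maximum that defines the value at `m`.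
  have h := lengthAngleEnergy_le (lengthOfLog_pos (l23 - m2 - m3)) (lengthOfLog_pos (l31 - m3 - m1))
    (lengthOfLog_pos (l12 - m1 - m2)) (hypAngle_nonneg _ _ _) (hypAngle_nonneg _ _ _)
    (hypAngle_nonneg _ _ _) (sum_hypAngle_le_pi (lengthOfLog_pos (l23 - l2 - l3))
      (lengthOfLog_pos (l31 - l3 - l1)) (lengthOfLog_pos (l12 - l1 - l2)))
  rw [twoVhat_eq, twoVhat_eq]
  simp only [lengthAngleEnergy_lengthOfLog] at *
  unfold angleEnergy at *
  linarith

theorem twoVhat_subgradient_lt {l12 l23 l31 l1 l2 l3 m1 m2 m3 : ℝ}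
    (ht : IsHypTriangle (lengthOfLog (l23 - l2 - l3)) (lengthOfLog (l31 - l3 - l1))
      (lengthOfLog (l12 - l1 - l2))) (hne : ¬(m1 = l1 ∧ m2 = l2 ∧ m3 = l3)) :
    twoVhat l12 l23 l31 l1 l2 l3
      + hypAngle (lengthOfLog (l23 - l2 - l3)) (lengthOfLog (l31 - l3 - l1))
          (lengthOfLog (l12 - l1 - l2)) * (m1 - l1)
      + hypAngle (lengthOfLog (l31 - l3 - l1)) (lengthOfLog (l12 - l1 - l2))
          (lengthOfLog (l23 - l2 - l3)) * (m2 - l2)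
      + hypAngle (lengthOfLog (l12 - l1 - l2)) (lengthOfLog (l23 - l2 - l3))
          (lengthOfLog (l31 - l3 - l1)) * (m3 - l3)
      < twoVhat l12 l23 l31 m1 m2 m3 := by
  have p1 := lengthOfLog_pos (l23 - m2 - m3)
  have p2 := lengthOfLog_pos (l31 - m3 - m1)
  have p3 := lengthOfLog_pos (l12 - m1 - m2)
  have h := lengthAngleEnergy_lt p1 p2 p3 ht.hypAngle_pos ht.cyclic.hypAngle_pos
    ht.cyclic.cyclic.hypAngle_pos ht.sum_hypAngle_lt_pi fun he => by
      obtain ⟨e1, e2, e3⟩ := he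
      have ht' : IsHypTriangle (lengthOfLog (l23 - m2 - m3)) (lengthOfLog (l31 - m3 - m1))
          (lengthOfLog (l12 - m1 - m2)) := by
        -- A broken triangle has a zero angle, but the common angles are positive.
        have a1 := ht.hypAngle_pos
        have a2 := ht.cyclic.hypAngle_pos
        have a3 := ht.cyclic.cyclic.hypAngle_pos
        obtain h | h | h | h := isHypTriangle_or p1 p2 p3
        · exact h
        · have := (hypAngle_of_add_le p1 p2 p3 h).2.1
          linarith
        · have := (hypAngle_of_add_le p2 p3 p1 h).2.1
          linarith
        · have := (hypAngle_of_add_le p3 p1 p2 h).2.1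
          linarith
      have d1 := lengthOfLog_injective (ht.length_eq ht' e1 e2 e3)
      have d2 := lengthOfLog_injective (ht.cyclic.length_eq ht'.cyclic e2 e3 e1)
      have d3 := lengthOfLog_injective (ht.cyclic.cyclic.length_eq ht'.cyclic.cyclic e3 e1 e2)
      exact hne ⟨by linarith, by linarith, by linarith⟩
  rw [twoVhat_eq, twoVhat_eq]
  simp only [lengthAngleEnergy_lengthOfLog] at *
  unfold angleEnergy at *
  linarith

/-! ### Functions with a continuous subgradient -/

theorem convexOn_of_subgradient {E : Type*} [NormedAddCommGroup E] [NormedSpace ℝ E] {f : E → ℝ}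
    {g : E → E →L[ℝ] ℝ} (h : ∀ u w, f u + g u (w - u) ≤ f w) : ConvexOn ℝ univ f := by
  refine ⟨convex_univ, fun x _ y _ a b ha hb hab => ?_⟩
  have h1 := mul_le_mul_of_nonneg_left (h (a • x + b • y) x) ha
  have h2 := mul_le_mul_of_nonneg_left (h (a • x + b • y) y) hb
  simp only [map_sub, map_add, map_smul, smul_eq_mul] at *
  have : b = 1 - a := by linarith
  subst this
  linarith

/-- The inequalities at `u` and at `w` enclose `f w - f u - g u (w - u)` between `0` and `(g w - g
u) (w - u)`, which is `o(‖w - u‖)` by continuity of `g`. -/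
theorem contDiff_one_of_subgradient {E : Type*} [NormedAddCommGroup E] [NormedSpace ℝ E]
    {f : E → ℝ} {g : E → E →L[ℝ] ℝ} (hg : Continuous g) (h : ∀ u w, f u + g u (w - u) ≤ f w) :
    ContDiff ℝ 1 f := by
  refine contDiff_one_iff_hasFDerivAt.2 ⟨g, hg, fun u => ?_⟩
  rw [hasFDerivAt_iff_isLittleO]
  refine Asymptotics.isLittleO_iff.2 fun ε hε => ?_
  filter_upwards [Metric.continuousAt_iff'.1 hg.continuousAt ε hε] with w hw
  have h1 := h u w
  have h2 := h w u
  have h3 := (g w - g u).le_opNorm (w - u)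
  have h4 : g w (u - w) = -g w (w - u) := by rw [← neg_sub w u, map_neg]
  rw [dist_eq_norm] at hw
  rw [Real.norm_eq_abs, abs_of_nonneg (by linarith)]
  have h5 := mul_le_mul_of_nonneg_right hw.le (norm_nonneg (w - u))
  have h6 := (le_abs_self _).trans h3
  simp only [sub_apply] at h6
  linarith

namespace SurfaceTriangulation

variable {V F : Type*} (T : SurfaceTriangulation V F)

/-! ### The energy -/

/-- The lengths with logarithmic lengths `λᵢⱼ + uᵢ + uⱼ`. -/
def scaledLength (lam : T.Edge → ℝ) (u : V → ℝ) (e : T.Edge) : ℝ :=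
  lengthOfLog (lam e + T.edgeSum u e)

/-- The corners `b`, `c` are separate variables so that the literals `0, 1, 2` can replace sums in
`Fin 3`. -/
theorem scaledLength_side (lam : T.Edge → ℝ) (u : V → ℝ) (f : F) (a b c : Fin 3) (hb : b = a + 1)
    (hc : c = a + 2) : T.scaledLength lam u (T.side f a)
      = lengthOfLog (lam (T.side f a) - -u (T.vert f b) - -u (T.vert f c)) := by
  subst hb hc
  rw [sub_neg_eq_add, sub_neg_eq_add, add_assoc]
  rfl

theorem continuous_scaledLength (lam : T.Edge → ℝ) (e : T.Edge) :
    Continuous fun u => T.scaledLength lam u e := by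
  obtain ⟨_, f, a, rfl⟩ := e
  refine continuous_lengthOfLog.comp (continuous_const.add ?_)
  change Continuous fun u : V → ℝ => u (T.vert f (a + 1)) + u (T.vert f (a + 2))
  fun_prop

theorem continuous_angle_scaledLength (lam : T.Edge → ℝ) (f : F) (a : Fin 3) :
    Continuous fun u => T.angle (T.scaledLength lam u) f a :=
  continuous_iff_continuousAt.2 fun _ => ContinuousAt.hypAngle
    (T.continuous_scaledLength _ _).continuousAt (T.continuous_scaledLength _ _).continuousAt
    (T.continuous_scaledLength _ _).continuousAt (lengthOfLog_pos _) (lengthOfLog_pos _)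

/-- The contribution of one triangle to the energy. -/
def faceEnergy (lam : T.Edge → ℝ) (u : V → ℝ) (f : F) : ℝ :=
  twoVhat (lam (T.side f 2)) (lam (T.side f 0)) (lam (T.side f 1))
    (-u (T.vert f 0)) (-u (T.vert f 1)) (-u (T.vert f 2))

theorem faceEnergy_subgradient (lam : T.Edge → ℝ) (u w : V → ℝ) (f : F) :
    T.faceEnergy lam u f - ∑ a, T.angle (T.scaledLength lam u) f a
      * (w (T.vert f a) - u (T.vert f a)) ≤ T.faceEnergy lam w f := by
  have := twoVhat_subgradient (lam (T.side f 2)) (lam (T.side f 0)) (lam (T.side f 1))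
    (-u (T.vert f 0)) (-u (T.vert f 1)) (-u (T.vert f 2))
    (-w (T.vert f 0)) (-w (T.vert f 1)) (-w (T.vert f 2))
  rw [← T.scaledLength_side lam u f 0 1 2 rfl rfl, ← T.scaledLength_side lam u f 1 2 0 rfl rfl,
    ← T.scaledLength_side lam u f 2 0 1 rfl rfl] at this
  rw [Fin.sum_univ_three]
  simp only [angle, faceEnergy]
  simp only [Fin.isValue, zero_add, Fin.reduceAdd] at *
  linarith

theorem faceEnergy_subgradient_lt {lam : T.Edge → ℝ} {u w : V → ℝ}
    (hu : T.IsDiscreteMetric (T.scaledLength lam u)) {f : F} {a : Fin 3}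
    (hne : w (T.vert f a) ≠ u (T.vert f a)) :
    T.faceEnergy lam u f - ∑ a, T.angle (T.scaledLength lam u) f a
      * (w (T.vert f a) - u (T.vert f a)) < T.faceEnergy lam w f := by
  have ht : IsHypTriangle (T.scaledLength lam u (T.side f 0)) (T.scaledLength lam u (T.side f 1))
    (T.scaledLength lam u (T.side f 2)) :=
    ⟨hu.1 _, hu.1 _, hu.1 _, hu.2 f 0, hu.2 f 1, hu.2 f 2⟩
  rw [T.scaledLength_side lam u f 0 1 2 rfl rfl, T.scaledLength_side lam u f 1 2 0 rfl rfl,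
    T.scaledLength_side lam u f 2 0 1 rfl rfl] at ht
  have := twoVhat_subgradient_lt (m1 := -w (T.vert f 0)) (m2 := -w (T.vert f 1))
    (m3 := -w (T.vert f 2)) ht fun h => by
      simp only [neg_inj] at h
      fin_cases a
      exacts [hne h.1, hne h.2.1, hne h.2.2]
  rw [← T.scaledLength_side lam u f 0 1 2 rfl rfl, ← T.scaledLength_side lam u f 1 2 0 rfl rfl,
    ← T.scaledLength_side lam u f 2 0 1 rfl rfl] at this
  rw [Fin.sum_univ_three]
  simp only [angle, faceEnergy]
  simp only [Fin.isValue, zero_add, Fin.reduceAdd] at *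
  linarith

/-! ### Scale factors -/

theorem scaledLength_logLength {l : T.Edge → ℝ} (hl : ∀ e, 0 < l e) (u : V → ℝ) :
    T.scaledLength (T.logLength l) u = T.confLength l u := by
  funext e
  have h : 0 < Real.sinh (l e / 2) := Real.sinh_pos_iff.2 (half_pos (hl e))
  rw [scaledLength, lengthOfLog, confLength, logLength, add_div,
    mul_div_cancel_left₀ _ two_ne_zero, Real.exp_add, Real.exp_log h, mul_comm (Real.sinh _)]

variable {T} in
theorem confLength_eq_iff {l lt : T.Edge → ℝ} {u : V → ℝ} : T.confLength l u = lt ↔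
    ∀ e, Real.sinh (lt e / 2) = Real.exp (T.edgeSum u e / 2) * Real.sinh (l e / 2) := by
  rw [funext_iff]
  refine forall_congr' fun e => ?_
  rw [confLength]
  constructor
  · intro h
    rw [← h, mul_div_cancel_left₀ _ two_ne_zero, Real.sinh_arsinh]
  · intro h
    rw [← h, Real.arsinh_sinh]
    ring

variable {T} in
theorem edgeSum_sub (u v : V → ℝ) (e : T.Edge) :
    T.edgeSum (u - v) e = T.edgeSum u e - T.edgeSum v e := by
  obtain ⟨_, f, a, rfl⟩ := e
  simp only [edgeSum, Sym2.lift_mk, Pi.sub_apply]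
  ring

variable {T} in
theorem IsConfClass.exists_confLength_eq {C : Set (T.Edge → ℝ)} (hC : T.IsConfClass C)
    {l lt : T.Edge → ℝ} (hl : l ∈ C) (hlt : lt ∈ C) : ∃ u, T.confLength l u = lt := by
  obtain ⟨l₀, -, rfl⟩ := hC
  obtain ⟨u, hu⟩ := hl.2
  obtain ⟨v, hv⟩ := hlt.2
  refine ⟨v - u, confLength_eq_iff.2 fun e => ?_⟩
  rw [hv, hu, ← mul_assoc, ← Real.exp_add, edgeSum_sub]
  congr 2
  ring

variable {T} in
theorem IsConfClass.isDiscreteMetric {C : Set (T.Edge → ℝ)} (hC : T.IsConfClass C)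
    {l : T.Edge → ℝ} (hl : l ∈ C) : T.IsDiscreteMetric l := by
  obtain ⟨l₀, -, rfl⟩ := hC
  exact hl.1

variable [Fintype F]

variable {T} in
-- With `V₀ = ∅` the prescribed factors, here `0`, play no role.
theorem SolvesAngleProblem.solvesMixedProblem {C : Set (T.Edge → ℝ)} (hC : T.IsConfClass C)
    {Θ : V → ℝ} {l lt : T.Edge → ℝ} (h : T.SolvesAngleProblem C Θ lt) {u : V → ℝ}
    (hu : T.confLength l u = lt) : T.SolvesMixedProblem l ∅ 0 Θ u :=
  ⟨fun _ h => h.elim, hu ▸ hC.isDiscreteMetric h.1, fun i _ => hu ▸ h.2 i⟩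

variable [Fintype V]

/-! ### The gradient of the energy -/

theorem sum_angleSum_mul (l : T.Edge → ℝ) (v : V → ℝ) :
    ∑ i, T.angleSum l i * v i = ∑ f, ∑ a, T.angle l f a * v (T.vert f a) := by
  classical
  simp only [angleSum, Finset.sum_mul]
  rw [Finset.sum_comm]
  refine Finset.sum_congr rfl fun f _ => ?_
  rw [Finset.sum_comm]
  refine Finset.sum_congr rfl fun a _ => ?_
  simp [ite_mul]

theorem energy_eq (Θ : V → ℝ) (lam : T.Edge → ℝ) (u : V → ℝ) :
    T.energy Θ lam u = ∑ f, T.faceEnergy lam u f + ∑ i, Θ i * u i := rfl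

/-- The difference of the prescribed and the actual angle sums, as a linear form. -/
def energyGradient (Θ : V → ℝ) (lam : T.Edge → ℝ) (u : V → ℝ) : (V → ℝ) →L[ℝ] ℝ :=
  ∑ i, (Θ i - T.angleSum (T.scaledLength lam u) i) • ContinuousLinearMap.proj i

theorem energyGradient_apply (Θ : V → ℝ) (lam : T.Edge → ℝ) (u v : V → ℝ) :
    T.energyGradient Θ lam u v
      = ∑ i, (Θ i - T.angleSum (T.scaledLength lam u) i) * v i := by
  simp [energyGradient]

theorem continuous_energyGradient (Θ : V → ℝ) (lam : T.Edge → ℝ) :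
    Continuous (T.energyGradient Θ lam) := by
  have h : ∀ i, Continuous fun u => T.angleSum (T.scaledLength lam u) i := fun i => by
    refine continuous_finsetSum _ fun f _ => continuous_finsetSum _ fun a _ => ?_
    split_ifs
    · exact T.continuous_angle_scaledLength lam f a
    · exact continuous_const
  exact continuous_finsetSum _ fun i _ => (continuous_const.sub (h i)).smul continuous_const

/-- Counting the corners by triangles instead of vertices splits the linearization into one term per
triangle. -/
theorem energy_add_energyGradient (Θ : V → ℝ) (lam : T.Edge → ℝ) (u w : V → ℝ) :
    T.energy Θ lam u + T.energyGradient Θ lam u (w - u)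
      = ∑ f, (T.faceEnergy lam u f - ∑ a, T.angle (T.scaledLength lam u) f a
          * (w (T.vert f a) - u (T.vert f a))) + ∑ i, Θ i * w i := by
  have h := T.sum_angleSum_mul (T.scaledLength lam u) (w - u)
  simp only [Pi.sub_apply] at h
  rw [energyGradient_apply, energy_eq, Finset.sum_sub_distrib, ← h]
  simp only [sub_mul, mul_sub, Finset.sum_sub_distrib, Pi.sub_apply]
  ring

theorem energy_subgradient (Θ : V → ℝ) (lam : T.Edge → ℝ) (u w : V → ℝ) :
    T.energy Θ lam u + T.energyGradient Θ lam u (w - u) ≤ T.energy Θ lam w := by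
  rw [energy_add_energyGradient, energy_eq]
  gcongr
  exact T.faceEnergy_subgradient lam u w _

theorem energy_subgradient_lt (Θ : V → ℝ) {lam : T.Edge → ℝ} {u w : V → ℝ}
    (hu : T.IsDiscreteMetric (T.scaledLength lam u)) (hne : w ≠ u) :
    T.energy Θ lam u + T.energyGradient Θ lam u (w - u) < T.energy Θ lam w := by
  obtain ⟨i, hi⟩ := Function.ne_iff.1 hne
  -- One triangle at a vertex where `w` and `u` differ is enough for strictness.
  obtain ⟨f, a, rfl⟩ := T.exists_vert i
  rw [energy_add_energyGradient, energy_eq]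
  gcongr 1
  exact Finset.sum_lt_sum (fun f _ => T.faceEnergy_subgradient lam u w f)
    ⟨f, Finset.mem_univ f, T.faceEnergy_subgradient_lt hu hi⟩

/-! ### The mapping problems -/

variable {T}

/-- In the linear term, `w - u` vanishes on `V₀` and the angle defect vanishes off `V₀`. -/
theorem SolvesMixedProblem.energy_lt {l : T.Edge → ℝ} (hl : ∀ e, 0 < l e) {V₀ : Set V}
    {u₀ Θ u w : V → ℝ} (h : T.SolvesMixedProblem l V₀ u₀ Θ u) (hw : ∀ i ∈ V₀, w i = u₀ i)
    (hne : w ≠ u) : T.energy Θ (T.logLength l) u < T.energy Θ (T.logLength l) w := by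
  obtain ⟨h1, h2, h3⟩ := h
  rw [← T.scaledLength_logLength hl] at h2 h3
  have h4 := T.energy_subgradient_lt Θ h2 hne
  rwa [energyGradient_apply, Finset.sum_eq_zero, add_zero] at h4
  intro i _
  by_cases hi : i ∈ V₀
  · rw [Pi.sub_apply, hw i hi, h1 i hi, sub_self, mul_zero]
  · rw [h3 i hi, sub_self, zero_mul]

theorem SolvesMixedProblem.unique {l : T.Edge → ℝ} (hl : ∀ e, 0 < l e) {V₀ : Set V}
    {u₀ Θ u u' : V → ℝ} (h : T.SolvesMixedProblem l V₀ u₀ Θ u)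
    (h' : T.SolvesMixedProblem l V₀ u₀ Θ u') : u' = u := by
  by_contra hne
  exact lt_asymm (h.energy_lt hl h'.1 hne) (h'.energy_lt hl h.1 (Ne.symm hne))

theorem SolvesMixedProblem.isMinOn_iff {l : T.Edge → ℝ} (hl : ∀ e, 0 < l e) {V₀ : Set V}
    {u₀ Θ u : V → ℝ} (h : T.SolvesMixedProblem l V₀ u₀ Θ u) (w : V → ℝ) :
    ((∀ i ∈ V₀, w i = u₀ i) ∧
      IsMinOn (T.energy Θ (T.logLength l)) {v | ∀ i ∈ V₀, v i = u₀ i} w) ↔ w = u := by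
  constructor
  · rintro ⟨hw, hmin⟩
    by_contra hne
    exact (h.energy_lt hl hw hne).not_ge (hmin h.1)
  · rintro rfl
    refine ⟨h.1, fun v hv => ?_⟩
    by_cases hne : v = w
    · subst hne
      exact le_refl (T.energy Θ (T.logLength l) v)
    · exact (h.energy_lt hl hv hne).le

end SurfaceTriangulation

end

theorem mainTheorem11 {V F : Type*} [Fintype V] [Fintype F] (T : SurfaceTriangulation V F) :
    -- the function is continuously differentiable and convex on the whole space
    (∀ (Θ : V → ℝ) (lam : T.Edge → ℝ),
      ContDiff ℝ 1 (T.energy Θ lam) ∧ ConvexOn ℝ Set.univ (T.energy Θ lam)) ∧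
    -- prescribed angle sums: the solution is unique, and for each representative of the class its
    -- logarithmic scale factors are the unique minimizer
    (∀ C : Set (T.Edge → ℝ), T.IsConfClass C → ∀ (Θ : V → ℝ) (lt : T.Edge → ℝ),
      T.SolvesAngleProblem C Θ lt →
        (∀ lt', T.SolvesAngleProblem C Θ lt' → lt' = lt) ∧
        ∀ l ∈ C, ∃ u : V → ℝ,
          (∀ e, Real.sinh (lt e / 2) = Real.exp (T.edgeSum u e / 2) * Real.sinh (l e / 2)) ∧
          ∀ w : V → ℝ, IsMinOn (T.energy Θ (T.logLength l)) Set.univ w ↔ w = u) ∧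
    -- scale factors prescribed on `V₀`, angle sums prescribed elsewhere: the solution is unique,
    -- and it is the unique minimizer under the constraint
    (∀ l : T.Edge → ℝ, (∀ e, 0 < l e) → ∀ (V₀ : Set V) (u₀ Θ u : V → ℝ),
      T.SolvesMixedProblem l V₀ u₀ Θ u →
        (∀ u', T.SolvesMixedProblem l V₀ u₀ Θ u' → u' = u) ∧
        ∀ w : V → ℝ, ((∀ i ∈ V₀, w i = u₀ i) ∧
          IsMinOn (T.energy Θ (T.logLength l)) {v | ∀ i ∈ V₀, v i = u₀ i} w) ↔ w = u) := by
  refine ⟨fun Θ lam => ⟨contDiff_one_of_subgradient (T.continuous_energyGradient Θ lam)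
    (T.energy_subgradient Θ lam), convexOn_of_subgradient (T.energy_subgradient Θ lam)⟩,
    fun C hC Θ lt h => ⟨fun lt' h' => ?_, fun l hl => ?_⟩,
    fun l hl V₀ u₀ Θ u h => ⟨fun u' => h.unique hl, h.isMinOn_iff hl⟩⟩
  -- Both solutions are described by scale factors relative to `lt` itself; uniqueness in the mixed
  -- problem makes these factors equal.
  · obtain ⟨u, hu⟩ := hC.exists_confLength_eq h.1 h.1
    obtain ⟨u', hu'⟩ := hC.exists_confLength_eq h.1 h'.1
    have := (h.solvesMixedProblem hC hu).unique (hC.isDiscreteMetric h.1).1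
      (h'.solvesMixedProblem hC hu')
    rw [← hu', this, hu]
  · obtain ⟨u, hu⟩ := hC.exists_confLength_eq hl h.1
    refine ⟨u, SurfaceTriangulation.confLength_eq_iff.1 hu, fun w => ?_⟩
    simpa using (h.solvesMixedProblem hC hu).isMinOn_iff (hC.isDiscreteMetric hl).1 w
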